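/- **Setting.** A Bayesian persuasion (BP) model is $G=(\Omega,A,\mu_0,u,v)$ with $\Omega$ a finite set of states, $A$ a finite nonempty set of actions, $\mu_0\in\Delta(\Omega)$ a prior of full support, and $u,v:A\times\Omega\to[0,1]$ the utilities of the receiver and of the sender. The sender has a finite message space $M$ with $|M|\ge|\Omega|$. A signal policy $\pi$ (with messages in $M$) is a splitting of the prior: weights $\alpha_m\ge 0$ with $\sum_{m\in M}\alpha_m=1$ and posteriors $\mu_m\in\Delta(\Omega)$ with $\sum_m\alpha_m\mu_m=\mu_0$; let $\Pi$ be the set of these policies. A type $\theta$ of the receiver is a utility function $u_\theta:A\times\Omega\to\mathbb R$. Let $\mathrm{opt}A_\theta(\mu)$ be the set of actions that maximize $\sum_\omega\mu(\omega)u_\theta(a,\omega)$, and let $$Ev_\theta(\pi)=\sum_{m}\alpha_m\max_{a\in \mathrm{opt}A_\theta(\mu_m)}\sum_\omega\mu_m(\omega)v(a,\omega),\qquad V(\theta)=\max_{\pi\in\Pi}Ev_\theta(\pi).$$ Let $\theta_0$ be the type with $u_{\theta_0}=u$. For $\delta>0$, a $\delta$-BP model that wraps $G$ is given by closed intervals $I_{a,\omega}$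 of length $\delta$ with $u(a,\omega)$ in the interior of $I_{a,\omega}$; its type set $\Theta$ is the set of all $\theta$ with $u_\theta(a,\omega)\in I_{a,\omega}$ for all $a,\omega$. A policy is *max-min* for $\Theta$ if it maximizes $\inf_{\theta\in\Theta}Ev_\theta(\pi)$ over $\Pi$, and *regret-minimizing* for $\Theta$ if it minimizes $\sup_{\theta\in\Theta}[V(\theta)-Ev_\theta(\pi)]$ over $\Pi$. * $G$ is *continuous* if for every $\epsilon>0$ there is $\delta_0>0$ such that for every $\delta<\delta_0$, every $\delta$-BP model that wraps $G$ and every $\theta\in\Theta$: $|V(\theta)-V(\theta_0)|<\epsilon$. * $G$ is *robust when the sender is max-min* (respectively *regret-minimizing*) if for every $\epsilon>0$ there is $\delta_0>0$ such that for every $\delta<\delta_0$, every $\delta$-BP model that wraps $G$, every $\theta\in\Theta$ and every max-min (respectively regret-minimizing) policy $\pi$ for $\Theta$: $|Ev_\theta(\pi)-V(\theta_0)|<\epsilon$. **Theorem 1.** For every BP model $G$ and every such $M$, the following are equivalent: 1. $G$ is robust when the sender is regret-minimizing; 2. $G$ is robust when the sender is max-min; 3. $G$ is continuous; 4. there is a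 policy $\pi\in\Pi$ that is optimal for $\theta_0$ (that is, $Ev_{\theta_0}(\pi)=V(\theta_0)$) such that for every posterior $\mu_m$ of positive weight there is an action $a\in\mathrm{opt}A_{\theta_0}(\mu_m)$ that is best for the sender at $\mu_m$ among all actions in $\mathrm{opt}A_{\theta_0}(\mu_m)$, whose best-reply region $\{\mu\in\Delta(\Omega): a\in\mathrm{opt}A_{\theta_0}(\mu)\}$ has dimension $|\Omega|-1$, and for which either no other action $b$ satisfies $u(b,\cdot)=u(a,\cdot)$, or every action $b$ with $u(b,\cdot)=u(a,\cdot)$ satisfies $\sum_\omega\mu_m(\omega)v(b,\omega)=\sum_\omega\mu_m(\omega)v(a,\omega)$. -/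

import Mathlib

open scoped BigOperators

/-- A Bayesian persuasion model with finite state set `Ω` and finite action set `A`: a full-support
prior, the receiver's utility `u` and the sender's utility `v`, both with values in `[0, 1]`. -/
structure BPModel (Ω A : Type*) [Fintype Ω] [Fintype A] where
  prior : Ω → ℝ
  prior_mem : prior ∈ stdSimplex ℝ Ω
  prior_pos : ∀ ω, 0 < prior ω
  u : A → Ω → ℝ
  v : A → Ω → ℝ
  u_mem : ∀ a ω, u a ω ∈ Set.Icc (0 : ℝ) 1
  v_mem : ∀ a ω, v a ω ∈ Set.Icc (0 : ℝ) 1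

namespace BPModel

/-- Expected utility `∑ ω, μ ω * w a ω` of the action `a` at the belief `μ`, for the utility
function `w` (the receiver's or the sender's). -/
def expUtil {Ω A : Type*} [Fintype Ω] (w : A → Ω → ℝ) (a : A) (μ : Ω → ℝ) : ℝ :=
  ∑ ω, μ ω * w a ω

open Classical in
/-- The best replies, at the belief `μ`, of a receiver whose utility function is `θ`.
A type of the receiver is identified with its utility function. -/
noncomputable def optA {Ω A : Type*} [Fintype Ω] [Fintype A] (θ : A → Ω → ℝ) (μ : Ω → ℝ) :
    Finset A :=
  Finset.univ.filter fun a => ∀ b, expUtil θ b μ ≤ expUtil θ a μ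

theorem optA_nonempty {Ω A : Type*} [Fintype Ω] [Fintype A] [Nonempty A]
    (θ : A → Ω → ℝ) (μ : Ω → ℝ) : (optA θ μ).Nonempty := by
  obtain ⟨a, -, ha⟩ := Finset.exists_max_image (Finset.univ : Finset A)
    (fun a => expUtil θ a μ) Finset.univ_nonempty
  exact ⟨a, by simpa [optA] using ha⟩

/-- The set of beliefs at which `a` is a best reply of the type `θ`. -/
def bestReplyRegion {Ω A : Type*} [Fintype Ω] [Fintype A] (θ : A → Ω → ℝ) (a : A) :
    Set (Ω → ℝ) :=
  {μ | μ ∈ stdSimplex ℝ Ω ∧ a ∈ optA θ μ}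

/-- A signal policy with message space `M`, in its representation as a splitting of the prior:
message `m` has probability `weight m` and leads to the posterior belief `posterior m`.
Messages of weight zero are not used (and do not contribute to any payoff). -/
structure Policy {Ω A : Type*} [Fintype Ω] [Fintype A] (G : BPModel Ω A)
    (M : Type*) [Fintype M] where
  weight : M → ℝ
  posterior : M → Ω → ℝ
  weight_mem : weight ∈ stdSimplex ℝ M
  posterior_mem : ∀ m, posterior m ∈ stdSimplex ℝ Ω
  splits : ∀ ω, ∑ m, weight m * posterior m ω = G.prior ω

section

variable {Ω A : Type*} [Fintype Ω] [Fintype A] [Nonempty A] (G : BPModel Ω A)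

/-- The sender's expected utility at the belief `μ` when the receiver is of type `θ` and
breaks ties in favour of the sender. -/
noncomputable def indirect (θ : A → Ω → ℝ) (μ : Ω → ℝ) : ℝ :=
  (optA θ μ).sup' (optA_nonempty θ μ) fun a => expUtil G.v a μ

/-- `a` is induced at the belief `μ`: a best reply of the type `θ` that is best for the sender
among the best replies. -/
def Induced (θ : A → Ω → ℝ) (μ : Ω → ℝ) (a : A) : Prop :=
  a ∈ optA θ μ ∧ ∀ b ∈ optA θ μ, expUtil G.v b μ ≤ expUtil G.v a μ

variable {M : Type*} [Fintype M]

/-- The sender's expected utility from the policy `π` when the receiver is of type `θ`. -/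
noncomputable def Ev (θ : A → Ω → ℝ) (π : G.Policy M) : ℝ :=
  ∑ m, π.weight m * G.indirect θ (π.posterior m)

/-- `π` is an optimal policy for the type `θ`. -/
def IsOptimal (θ : A → Ω → ℝ) (π : G.Policy M) : Prop :=
  ∀ π' : G.Policy M, G.Ev θ π' ≤ G.Ev θ π

variable (M) in
/-- The sender's optimal value when she knows that the receiver is of type `θ`. All values of
`Ev` lie in `[0, 1]`. -/
noncomputable def optValue (θ : A → Ω → ℝ) : ℝ :=
  ⨆ π : G.Policy M, G.Ev θ π

/-- The types of the interval model with lower end points `lo` and interval length `δ`: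
all profiles in the product of the intervals `[lo a ω, lo a ω + δ]`. -/
def typeSpace {Ω A : Type*} (lo : A → Ω → ℝ) (δ : ℝ) : Set (A → Ω → ℝ) :=
  {θ | ∀ a ω, θ a ω ∈ Set.Icc (lo a ω) (lo a ω + δ)}

/-- The interval model with lower end points `lo` and interval length `δ` wraps `G`:
the receiver's utility in `G` is an interior type. -/
def Wraps {Ω A : Type*} [Fintype Ω] [Fintype A] (lo : A → Ω → ℝ) (δ : ℝ) (G : BPModel Ω A) :
    Prop :=
  ∀ a ω, G.u a ω ∈ Set.Ioo (lo a ω) (lo a ω + δ)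

/-- The sender's worst-case expected utility over a set of types. -/
noncomputable def minUtility (Θ : Set (A → Ω → ℝ)) (π : G.Policy M) : ℝ :=
  ⨅ θ : Θ, G.Ev θ.1 π

/-- The sender's worst-case regret over a set of types. -/
noncomputable def regret (Θ : Set (A → Ω → ℝ)) (π : G.Policy M) : ℝ :=
  ⨆ θ : Θ, (G.optValue M θ.1 - G.Ev θ.1 π)

def IsMaxMin (Θ : Set (A → Ω → ℝ)) (π : G.Policy M) : Prop :=
  ∀ π' : G.Policy M, G.minUtility Θ π' ≤ G.minUtility Θ π

def IsRegretMinimizing (Θ : Set (A → Ω → ℝ)) (π : G.Policy M) : Prop :=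
  ∀ π' : G.Policy M, G.regret Θ π ≤ G.regret Θ π'

variable (M)

/-- Continuity of the model. -/
def IsContinuous : Prop :=
  ∀ ε > 0, ∃ δ₀ > 0, ∀ δ < δ₀, ∀ lo : A → Ω → ℝ, Wraps lo δ G →
    ∀ θ ∈ typeSpace lo δ, |G.optValue M θ - G.optValue M G.u| < ε

/-- Robustness when the sender is max-min. -/
def RobustMaxMin : Prop :=
  ∀ ε > 0, ∃ δ₀ > 0, ∀ δ < δ₀, ∀ lo : A → Ω → ℝ, Wraps lo δ G →
    ∀ θ ∈ typeSpace lo δ, ∀ π : G.Policy M, G.IsMaxMin (typeSpace lo δ) π →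
      |G.Ev θ π - G.optValue M G.u| < ε

/-- Robustness when the sender is regret-minimizing. -/
def RobustRegret : Prop :=
  ∀ ε > 0, ∃ δ₀ > 0, ∀ δ < δ₀, ∀ lo : A → Ω → ℝ, Wraps lo δ G →
    ∀ θ ∈ typeSpace lo δ, ∀ π : G.Policy M, G.IsRegretMinimizing (typeSpace lo δ) π →
      |G.Ev θ π - G.optValue M G.u| < ε

end

/-- No other action gives the receiver the same utility in every state. -/
def PropU1 {Ω A : Type*} [Fintype Ω] [Fintype A] (G : BPModel Ω A) (a : A) : Prop :=
  ∀ b, b ≠ a → ∃ ω, G.u a ω ≠ G.u b ω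

/-- Every action that gives the receiver the same utility as `a` in every state gives the sender
the same expected utility as `a` at the belief `μ`. -/
def PropU1S {Ω A : Type*} [Fintype Ω] [Fintype A] (G : BPModel Ω A) (μ : Ω → ℝ) (a : A) : Prop :=
  ∀ b, (∀ ω, G.u b ω = G.u a ω) → expUtil G.v b μ = expUtil G.v a μ

/-- The best-reply region of `a` has the same dimension `|Ω| - 1` as the simplex. -/
def PropU2 {Ω A : Type*} [Fintype Ω] [Fintype A] (G : BPModel Ω A) (a : A) : Prop :=
  Module.finrank ℝ (vectorSpan ℝ (bestReplyRegion G.u a)) + 1 = Fintype.card Ω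

/-- Some optimal policy is such that at each of its posteriors (those of positive weight) some
induced action has a full-dimensional best-reply region and has no receiver-duplicate, or only
receiver-duplicates that are equivalent for the sender at that posterior. -/
def StablePolicyCondition {Ω A : Type*} [Fintype Ω] [Fintype A] [Nonempty A] (G : BPModel Ω A)
    (M : Type*) [Fintype M] : Prop :=
  ∃ π : G.Policy M, G.IsOptimal G.u π ∧ ∀ m, 0 < π.weight m →
    ∃ a, G.Induced G.u (π.posterior m) a ∧ (G.PropU1 a ∨ G.PropU1S (π.posterior m) a) ∧
      G.PropU2 a

end BPModel

/-!
Each of the two robustness properties and continuity is equivalent to the existence of a stable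
policy, that is, to `StablePolicyCondition`.

*From robustness or continuity to a stable policy.* Each of the three properties gives, in every
small interval model and against every type in it, a policy whose payoff is almost the value at
`G.u`; for the robustness properties this uses that max-min and regret-minimizing policies exist
(`exists_isMaxMin`, `exists_isRegretMinimizing`), by compactness of the set of policies and upper
semicontinuity of the payoff (`le_Ev_of_tendsto`). It is applied to `adverseType`, a type near
`G.u` that avoids all actions with lower-dimensional best-reply regions and breaks ties between
duplicate actions against the sender. Lower-dimensional actions can be avoided because the
full-dimensional regions cover the simplex (`exists_propU2_mem_optA`). A limit of policies that do
well against adverse types is stable (`stablePolicyCondition_of_adverseType`).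

*From a stable policy to robustness and continuity.* Each posterior of a stable policy is moved
slightly into the interior of the best-reply region of its action, so that all types near `G.u`
choose that action or a duplicate of it (`exists_perturbed_belief`). As the prior has full support,
most of the perturbed splitting fits below the prior, and the rest is split into point masses. The
additional messages are then removed by a Carathéodory argument (`exists_policy_of_splitting`).
The result is a single policy whose payoff is almost the value at `G.u` for all nearby types
(`exists_policy_eventually_ge`). The value itself is upper semicontinuous
(`eventually_optValue_lt`), and these two facts bound the value, and the payoffs of max-min and
regret-minimizing policies, from both sides.
-/

open Filter Topology

namespace BPModel

/-! ### Expected utilities and best replies -/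

section

variable {Ω A : Type*} [Fintype Ω]

lemma continuous_expUtil (a : A) :
    Continuous fun q : (A → Ω → ℝ) × (Ω → ℝ) => expUtil q.1 a q.2 := by
  unfold expUtil
  fun_prop

lemma expUtil_mem_Icc {w : A → Ω → ℝ} (hw : ∀ a ω, w a ω ∈ Set.Icc (0 : ℝ) 1) (a : A)
    {μ : Ω → ℝ} (hμ : μ ∈ stdSimplex ℝ Ω) : expUtil w a μ ∈ Set.Icc (0 : ℝ) 1 := by
  refine ⟨Finset.sum_nonneg fun ω _ => mul_nonneg (hμ.1 ω) (hw a ω).1, ?_⟩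
  rw [← hμ.2]
  exact Finset.sum_le_sum fun ω _ => mul_le_of_le_one_right (hμ.1 ω) (hw a ω).2

lemma expUtil_add (w : A → Ω → ℝ) (a : A) (x y : Ω → ℝ) :
    expUtil w a (x + y) = expUtil w a x + expUtil w a y := by
  simp [expUtil, add_mul, Finset.sum_add_distrib]

lemma expUtil_smul (w : A → Ω → ℝ) (a : A) (c : ℝ) (x : Ω → ℝ) :
    expUtil w a (c • x) = c * expUtil w a x := by
  simp [expUtil, Finset.mul_sum, mul_assoc]

lemma expUtil_sum {ι : Type*} (s : Finset ι) (w : A → Ω → ℝ) (a : A) (x : ι → Ω → ℝ) :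
    expUtil w a (∑ i ∈ s, x i) = ∑ i ∈ s, expUtil w a (x i) := by
  simp only [expUtil, Finset.sum_apply, Finset.sum_mul]
  exact Finset.sum_comm

lemma expUtil_congr {w w' : A → Ω → ℝ} {a b : A} (h : ∀ ω, w a ω = w' b ω) (μ : Ω → ℝ) :
    expUtil w a μ = expUtil w' b μ := by
  simp [expUtil, h]

variable [Fintype A]

lemma mem_optA {θ : A → Ω → ℝ} {μ : Ω → ℝ} {a : A} :
    a ∈ optA θ μ ↔ ∀ b, expUtil θ b μ ≤ expUtil θ a μ := by
  simp [optA]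

lemma nonempty_states (G : BPModel Ω A) : Nonempty Ω := by
  by_contra h
  rw [not_nonempty_iff] at h
  simpa using G.prior_mem.2

lemma nonempty_policy (G : BPModel Ω A) {M : Type*} [Fintype M] [Nonempty M] :
    Nonempty (G.Policy M) := by
  classical
  obtain ⟨m₀⟩ := ‹Nonempty M›
  exact ⟨{ weight := Pi.single m₀ 1
           posterior := fun _ => G.prior
           weight_mem := single_mem_stdSimplex ℝ m₀
           posterior_mem := fun _ => G.prior_mem
           splits := fun ω => by simp [← Finset.sum_mul] }⟩

/-- The set of policies is compact, phrased with ultrafilters. -/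
lemma exists_policy_tendsto (G : BPModel Ω A) {M : Type*} [Fintype M] {ι : Type*}
    (F : Ultrafilter ι) (π : ι → G.Policy M) :
    ∃ ρ : G.Policy M, (∀ m, Tendsto (fun i => (π i).weight m) F (𝓝 (ρ.weight m))) ∧
      ∀ m, Tendsto (fun i => (π i).posterior m) F (𝓝 (ρ.posterior m)) := by
  obtain ⟨w, hw, hwt⟩ := (isCompact_stdSimplex ℝ M).ultrafilter_le_nhds
    (F.map fun i => (π i).weight) (tendsto_principal.2 (Eventually.of_forall fun i => (π i).weight_mem))
  have hpost := fun m => (isCompact_stdSimplex ℝ Ω).ultrafilter_le_nhds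
    (F.map fun i => (π i).posterior m)
    (tendsto_principal.2 (Eventually.of_forall fun i => (π i).posterior_mem m))
  choose p hp hpt using hpost
  have hwt' : ∀ m, Tendsto (fun i => (π i).weight m) F (𝓝 (w m)) := tendsto_pi_nhds.1 hwt
  refine ⟨⟨w, p, hw, hp, fun ω => ?_⟩, hwt', hpt⟩
  have h : Tendsto (fun i => ∑ m, (π i).weight m * (π i).posterior m ω) F
      (𝓝 (∑ m, w m * p m ω)) :=
    tendsto_finsetSum _ fun m _ => (hwt' m).mul (tendsto_pi_nhds.1 (hpt m) ω)
  simp only [(π _).splits] at h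
  exact (tendsto_nhds_unique h tendsto_const_nhds)

variable [Nonempty A] (G : BPModel Ω A)

lemma exists_induced (θ : A → Ω → ℝ) (μ : Ω → ℝ) : ∃ a, G.Induced θ μ a :=
  (optA θ μ).exists_max_image (fun a => expUtil G.v a μ) (optA_nonempty θ μ)

lemma Induced.indirect_eq {G : BPModel Ω A} {θ : A → Ω → ℝ} {μ : Ω → ℝ} {a : A}
    (h : G.Induced θ μ a) : G.indirect θ μ = expUtil G.v a μ :=
  le_antisymm (Finset.sup'_le _ _ h.2) (Finset.le_sup' (fun a => expUtil G.v a μ) h.1)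

lemma le_indirect {θ : A → Ω → ℝ} {μ : Ω → ℝ} {a : A} (h : a ∈ optA θ μ) :
    expUtil G.v a μ ≤ G.indirect θ μ :=
  Finset.le_sup' (fun a => expUtil G.v a μ) h

lemma indirect_mem_Icc (θ : A → Ω → ℝ) {μ : Ω → ℝ} (hμ : μ ∈ stdSimplex ℝ Ω) :
    G.indirect θ μ ∈ Set.Icc (0 : ℝ) 1 := by
  obtain ⟨a, ha⟩ := G.exists_induced θ μ
  rw [ha.indirect_eq]
  exact expUtil_mem_Icc G.v_mem a hμ

variable {M : Type*} [Fintype M]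

lemma Ev_mem_Icc (θ : A → Ω → ℝ) (π : G.Policy M) : G.Ev θ π ∈ Set.Icc (0 : ℝ) 1 := by
  have h := fun m => G.indirect_mem_Icc θ (π.posterior_mem m)
  refine ⟨Finset.sum_nonneg fun m _ => mul_nonneg (π.weight_mem.1 m) (h m).1, ?_⟩
  rw [← π.weight_mem.2]
  exact Finset.sum_le_sum fun m _ => mul_le_of_le_one_right (π.weight_mem.1 m) (h m).2

lemma bddAbove_Ev (θ : A → Ω → ℝ) : BddAbove (Set.range fun π : G.Policy M => G.Ev θ π) :=
  ⟨1, by rintro _ ⟨π, rfl⟩; exact (G.Ev_mem_Icc θ π).2⟩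

lemma Ev_le_optValue (θ : A → Ω → ℝ) (π : G.Policy M) : G.Ev θ π ≤ G.optValue M θ :=
  le_ciSup (G.bddAbove_Ev θ) π

variable (M) in
lemma optValue_mem_Icc (θ : A → Ω → ℝ) : G.optValue M θ ∈ Set.Icc (0 : ℝ) 1 :=
  ⟨Real.iSup_nonneg fun π => (G.Ev_mem_Icc θ π).1,
    Real.iSup_le (fun π => (G.Ev_mem_Icc θ π).2) zero_le_one⟩

/-! ### Upper semicontinuity, and existence of optimal policies -/

/-- Along an ultrafilter the induced actions are eventually constant, since there are finitely
many profiles of them, and they stay best replies in the limit. They need not be induced there: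
the sender may prefer another best reply. -/
lemma exists_actions_tendsto {ι : Type*} (F : Ultrafilter ι) {π : ι → G.Policy M}
    {ρ : G.Policy M} {θ : ι → A → Ω → ℝ} {ϑ : A → Ω → ℝ}
    (hw : ∀ m, Tendsto (fun i => (π i).weight m) F (𝓝 (ρ.weight m)))
    (hp : ∀ m, Tendsto (fun i => (π i).posterior m) F (𝓝 (ρ.posterior m)))
    (hθ : Tendsto θ F (𝓝 ϑ)) :
    ∃ a : M → A, (∀ᶠ i in F, ∀ m, G.Induced (θ i) ((π i).posterior m) (a m)) ∧
      (∀ m, a m ∈ optA ϑ (ρ.posterior m)) ∧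
      Tendsto (fun i => G.Ev (θ i) (π i)) F
        (𝓝 (∑ m, ρ.weight m * expUtil G.v (a m) (ρ.posterior m))) := by
  choose α hα using fun i m => G.exists_induced (θ i) ((π i).posterior m)
  obtain ⟨a, ha⟩ := (F.map α).eq_pure_of_finite
  have hconst : ∀ᶠ i in F, α i = a := by
    have : {a} ∈ F.map α := by rw [ha]; exact Ultrafilter.mem_pure.2 rfl
    exact this
  have hind : ∀ᶠ i in F, ∀ m, G.Induced (θ i) ((π i).posterior m) (a m) :=
    hconst.mono fun i hi m => hi ▸ hα i m
  have hlim : ∀ b m, Tendsto (fun i => expUtil (θ i) b ((π i).posterior m)) F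
      (𝓝 (expUtil ϑ b (ρ.posterior m))) := fun b m =>
    ((continuous_expUtil b).tendsto (ϑ, ρ.posterior m)).comp (hθ.prodMk_nhds (hp m))
  refine ⟨a, hind, fun m => mem_optA.2 fun b => ?_, ?_⟩
  · exact le_of_tendsto_of_tendsto (hlim b m) (hlim (a m) m)
      (hind.mono fun i hi => mem_optA.1 (hi m).1 b)
  · refine Tendsto.congr' (f₁ := fun i =>
      ∑ m, (π i).weight m * expUtil G.v (a m) ((π i).posterior m)) ?_ ?_
    · filter_upwards [hind] with i hi
      exact Finset.sum_congr rfl fun m _ => by rw [(hi m).indirect_eq]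
    · exact tendsto_finsetSum _ fun m _ => (hw m).mul
        (((continuous_expUtil (a m)).tendsto (G.v, ρ.posterior m)).comp
          (tendsto_const_nhds.prodMk_nhds (hp m)))

lemma sum_expUtil_le_Ev {θ : A → Ω → ℝ} (π : G.Policy M) {a : M → A}
    (ha : ∀ m, a m ∈ optA θ (π.posterior m)) :
    ∑ m, π.weight m * expUtil G.v (a m) (π.posterior m) ≤ G.Ev θ π :=
  Finset.sum_le_sum fun m _ =>
    mul_le_mul_of_nonneg_left (G.le_indirect (ha m)) (π.weight_mem.1 m)

/-- The sender's payoff is jointly upper semicontinuous in the type and the policy. -/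
lemma le_Ev_of_tendsto {ι : Type*} (F : Ultrafilter ι) {π : ι → G.Policy M}
    {ρ : G.Policy M} {θ : ι → A → Ω → ℝ} {ϑ : A → Ω → ℝ}
    (hw : ∀ m, Tendsto (fun i => (π i).weight m) F (𝓝 (ρ.weight m)))
    (hp : ∀ m, Tendsto (fun i => (π i).posterior m) F (𝓝 (ρ.posterior m)))
    (hθ : Tendsto θ F (𝓝 ϑ)) {c : ι → ℝ} {c₀ : ℝ} (hc : Tendsto c F (𝓝 c₀))
    (h : ∀ᶠ i in F, c i ≤ G.Ev (θ i) (π i)) : c₀ ≤ G.Ev ϑ ρ := by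
  obtain ⟨a, -, ha, hlim⟩ := G.exists_actions_tendsto F hw hp hθ
  exact (le_of_tendsto_of_tendsto hc hlim h).trans (G.sum_expUtil_le_Ev ρ ha)

/-- The optimal value is upper semicontinuous in the type. -/
lemma eventually_optValue_lt [Nonempty M] (ϑ : A → Ω → ℝ) {ε : ℝ} (hε : 0 < ε) :
    ∀ᶠ θ in 𝓝 ϑ, G.optValue M θ < G.optValue M ϑ + ε := by
  have := G.nonempty_policy (M := M)
  by_contra hcon
  rw [not_eventually] at hcon
  have : NeBot (𝓝 ϑ ⊓ 𝓟 {θ | ¬ G.optValue M θ < G.optValue M ϑ + ε}) :=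
    frequently_iff_neBot.1 hcon
  set F := Ultrafilter.of (𝓝 ϑ ⊓ 𝓟 {θ | ¬ G.optValue M θ < G.optValue M ϑ + ε})
  have hF : (F : Filter (A → Ω → ℝ)) ≤
      𝓝 ϑ ⊓ 𝓟 {θ | ¬ G.optValue M θ < G.optValue M ϑ + ε} := Ultrafilter.of_le _
  choose π hπ using fun θ => exists_lt_of_lt_ciSup
    (show G.optValue M θ - ε / 2 < ⨆ π : G.Policy M, G.Ev θ π from sub_lt_self _ (half_pos hε))
  obtain ⟨ρ, hw, hp⟩ := G.exists_policy_tendsto F π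
  have h := G.le_Ev_of_tendsto F hw hp (θ := id) (hF.trans inf_le_left)
    (tendsto_const_nhds (x := G.optValue M ϑ + ε / 2)) (by
      filter_upwards [hF.trans inf_le_right (mem_principal_self _)] with θ hθ
      have h₁ := hπ θ
      have h₂ : ¬ G.optValue M θ < G.optValue M ϑ + ε := hθ
      simp only [id]
      linarith)
  linarith [G.Ev_le_optValue ϑ ρ]

lemma minUtility_le {Θ : Set (A → Ω → ℝ)} (π : G.Policy M) {θ : A → Ω → ℝ} (hθ : θ ∈ Θ) :
    G.minUtility Θ π ≤ G.Ev θ π :=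
  ciInf_le (f := fun θ : Θ => G.Ev θ.1 π)
    ⟨0, by rintro _ ⟨θ, rfl⟩; exact (G.Ev_mem_Icc θ.1 π).1⟩ ⟨θ, hθ⟩

lemma exists_isMaxMin [Nonempty M] {Θ : Set (A → Ω → ℝ)} (hΘ : Θ.Nonempty) :
    ∃ π : G.Policy M, G.IsMaxMin Θ π := by
  have := G.nonempty_policy (M := M)
  have := hΘ.to_subtype
  have hbdd : BddAbove (Set.range fun π : G.Policy M => G.minUtility Θ π) := by
    obtain ⟨θ, hθ⟩ := hΘ
    exact ⟨1, by rintro _ ⟨π, rfl⟩; exact (G.minUtility_le π hθ).trans (G.Ev_mem_Icc θ π).2⟩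
  obtain ⟨c, -, hc, hmem⟩ := exists_seq_tendsto_sSup (Set.range_nonempty _) hbdd
  choose π hπ using hmem
  obtain ⟨ρ, hw, hp⟩ := G.exists_policy_tendsto (hyperfilter ℕ) π
  refine ⟨ρ, fun π' => (le_csSup hbdd ⟨π', rfl⟩).trans (le_ciInf fun θ => ?_)⟩
  exact G.le_Ev_of_tendsto (hyperfilter ℕ) hw hp tendsto_const_nhds
    (hc.mono_left (Nat.hyperfilter_le_atTop)) (Eventually.of_forall fun n => by
      rw [← hπ n]; exact G.minUtility_le (π n) θ.2)

lemma le_regret (Θ : Set (A → Ω → ℝ)) (π : G.Policy M) {θ : A → Ω → ℝ} (hθ : θ ∈ Θ) :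
    G.optValue M θ - G.Ev θ π ≤ G.regret Θ π :=
  le_ciSup (f := fun θ : Θ => G.optValue M θ.1 - G.Ev θ.1 π)
    ⟨1, by
      rintro _ ⟨θ, rfl⟩
      exact (sub_le_self _ (G.Ev_mem_Icc θ.1 π).1).trans (G.optValue_mem_Icc M θ.1).2⟩ ⟨θ, hθ⟩

lemma exists_isRegretMinimizing [Nonempty M] {Θ : Set (A → Ω → ℝ)} (hΘ : Θ.Nonempty) :
    ∃ π : G.Policy M, G.IsRegretMinimizing Θ π := by
  have := G.nonempty_policy (M := M)
  have := hΘ.to_subtype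
  have hbdd : BddBelow (Set.range fun π : G.Policy M => G.regret Θ π) := by
    refine ⟨0, ?_⟩
    rintro _ ⟨π, rfl⟩
    exact Real.iSup_nonneg fun θ => sub_nonneg.2 (G.Ev_le_optValue θ.1 π)
  obtain ⟨c, -, hc, hmem⟩ := exists_seq_tendsto_sInf (Set.range_nonempty _) hbdd
  choose π hπ using hmem
  obtain ⟨ρ, hw, hp⟩ := G.exists_policy_tendsto (hyperfilter ℕ) π
  refine ⟨ρ, fun π' => le_trans (ciSup_le fun θ => ?_) (csInf_le hbdd ⟨π', rfl⟩)⟩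
  have h := G.le_Ev_of_tendsto (hyperfilter ℕ) hw hp tendsto_const_nhds
    ((hc.mono_left (Nat.hyperfilter_le_atTop)).const_sub (G.optValue M θ.1))
    (Eventually.of_forall fun n => by
      have := G.le_regret Θ (π n) θ.2
      have := hπ n
      simp only at this
      linarith)
  linarith

end

/-! ### Full-dimensional best-reply regions -/

section

variable {Ω A : Type*} [Fintype Ω]

/-- `expUtil` as a linear functional of the belief. -/
def expUtilₗ (w : A → Ω → ℝ) (a : A) : (Ω → ℝ) →ₗ[ℝ] ℝ where
  toFun := expUtil w a
  map_add' := expUtil_add w a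
  map_smul' := expUtil_smul w a

variable (Ω) in
/-- The total mass of a signed measure on `Ω`. Its kernel is the direction of the simplex. -/
def mass : (Ω → ℝ) →ₗ[ℝ] ℝ := ∑ ω, LinearMap.proj ω

lemma mass_apply (x : Ω → ℝ) : mass Ω x = ∑ ω, x ω := by simp [mass]

lemma finrank_ker_mass [Nonempty Ω] :
    Module.finrank ℝ (LinearMap.ker (mass Ω)) + 1 = Fintype.card Ω := by
  classical
  have hne : mass Ω ≠ 0 := fun h => by
    have := congrArg (fun f => f (Pi.single (Classical.arbitrary Ω) (1 : ℝ))) h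
    simp [mass_apply] at this
  have h := (mass Ω).finrank_range_add_finrank_ker
  rw [LinearMap.range_eq_top.2 ((mass Ω).surjective hne), finrank_top, Module.finrank_self,
    Module.finrank_fintype_fun_eq_card] at h
  omega

variable [Fintype A]

lemma vectorSpan_bestReplyRegion_le (θ : A → Ω → ℝ) (a : A) :
    vectorSpan ℝ (bestReplyRegion θ a) ≤ LinearMap.ker (mass Ω) := by
  rw [vectorSpan, Submodule.span_le]
  rintro _ ⟨x, hx, y, hy, rfl⟩
  simp [mass_apply, hx.1.2, hy.1.2]

lemma propU2_iff (G : BPModel Ω A) (a : A) :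
    G.PropU2 a ↔ vectorSpan ℝ (bestReplyRegion G.u a) = LinearMap.ker (mass Ω) := by
  have := G.nonempty_states
  have h := finrank_ker_mass (Ω := Ω)
  refine ⟨fun ha => ?_, fun ha => by rw [PropU2, ha, h]⟩
  refine Submodule.eq_of_le_of_finrank_eq (vectorSpan_bestReplyRegion_le _ _) ?_
  rw [PropU2] at ha
  omega

lemma mem_optA_smul {θ : A → Ω → ℝ} {x : Ω → ℝ} {a : A} (ha : a ∈ optA θ x) {c : ℝ}
    (hc : 0 ≤ c) : a ∈ optA θ (c • x) :=
  mem_optA.2 fun b => by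
    rw [expUtil_smul, expUtil_smul]
    exact mul_le_mul_of_nonneg_left (mem_optA.1 ha b) hc

lemma inv_mass_smul_mem [Nonempty Ω] {x : Ω → ℝ} (hx : ∀ ω, 0 < x ω) :
    (mass Ω x)⁻¹ • x ∈ stdSimplex ℝ Ω := by
  have hpos : 0 < mass Ω x := by
    rw [mass_apply]; exact Finset.sum_pos (fun ω _ => hx ω) Finset.univ_nonempty
  refine ⟨fun ω => mul_nonneg (inv_nonneg.2 hpos.le) (hx ω).le, ?_⟩
  rw [← mass_apply, map_smul, smul_eq_mul, inv_mul_cancel₀ hpos.ne']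

lemma isOpen_pos : IsOpen {x : Ω → ℝ | ∀ ω, 0 < x ω} := by
  simp only [Set.ofPred_forall]
  exact isOpen_iInter_of_finite fun ω => isOpen_lt continuous_const (continuous_apply ω)

/-- An action that is a best reply throughout a neighbourhood of a positive vector, in the cone
over the simplex, has a full-dimensional best-reply region. -/
lemma propU2_of_eventually (G : BPModel Ω A) {a : A} {x : Ω → ℝ} (hx : ∀ ω, 0 < x ω)
    (ha : ∀ᶠ y in 𝓝 x, a ∈ optA G.u y) : G.PropU2 a := by
  have := G.nonempty_states
  refine (G.propU2_iff a).2 (le_antisymm (vectorSpan_bestReplyRegion_le _ _) fun z hz => ?_)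
  have hz' : mass Ω z = 0 := hz
  have hpos : 0 < mass Ω x := by
    rw [mass_apply]; exact Finset.sum_pos (fun ω _ => hx ω) Finset.univ_nonempty
  have hlim : Tendsto (fun s : ℝ => x + s • z) (𝓝[>] 0) (𝓝 x) := by
    have : Continuous fun s : ℝ => x + s • z := by fun_prop
    simpa using (this.tendsto 0).mono_left nhdsWithin_le_nhds
  obtain ⟨s, ⟨hsa, hspos⟩, hs⟩ :=
    ((hlim.eventually (ha.and (isOpen_pos.mem_nhds hx))).and self_mem_nhdsWithin).exists
  have hs : 0 < s := hs
  have hmass : mass Ω (x + s • z) = mass Ω x := by simp [hz']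
  have h₀ : (mass Ω x)⁻¹ • x ∈ bestReplyRegion G.u a :=
    ⟨inv_mass_smul_mem hx, mem_optA_smul ha.self_of_nhds (inv_nonneg.2 hpos.le)⟩
  have h₁ : (mass Ω x)⁻¹ • (x + s • z) ∈ bestReplyRegion G.u a :=
    ⟨hmass ▸ inv_mass_smul_mem hspos, mem_optA_smul hsa (inv_nonneg.2 hpos.le)⟩
  have h := Submodule.smul_mem _ (mass Ω x / s) (vsub_mem_vectorSpan ℝ h₁ h₀)
  convert h using 1
  ext ω
  simp only [vsub_eq_sub, Pi.smul_apply, Pi.sub_apply, Pi.add_apply, smul_eq_mul]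
  field_simp
  ring

/-- The full-dimensional best-reply regions cover the simplex: off finitely many hyperplanes a
best reply stays one nearby, hence has a full-dimensional region, and the union of finitely many
closed regions is closed. -/
lemma exists_propU2_mem_optA [Nonempty A] (G : BPModel Ω A) {μ : Ω → ℝ} (hμ : ∀ ω, 0 ≤ μ ω) :
    ∃ a, G.PropU2 a ∧ a ∈ optA G.u μ := by
  classical
  let T : Set (Ω → ℝ) := ⋃ a ∈ {a | G.PropU2 a}, {x | a ∈ optA G.u x}
  have hcont : ∀ a, Continuous (expUtil G.u a) := fun a =>
    (continuous_expUtil a).comp (Continuous.prodMk_right G.u)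
  have hT : IsClosed T := by
    refine (Set.toFinite _).isClosed_biUnion fun a _ => ?_
    simp only [mem_optA, Set.ofPred_forall]
    exact isClosed_iInter fun b => isClosed_le (hcont b) (hcont a)
  let ι := {q : A × A // ∃ ω, G.u q.1 ω ≠ G.u q.2 ω}
  let R : Set (Ω → ℝ) := ⋂ q : ι, {x | expUtil G.u q.1.1 x ≠ expUtil G.u q.1.2 x}
  have hR : Dense R := by
    refine dense_iInter_of_isOpen (fun q => isOpen_ne_fun (hcont _) (hcont _)) ?_
    rintro ⟨⟨a, b⟩, ω, hω⟩
    have hne : expUtilₗ G.u a - expUtilₗ G.u b ≠ 0 := fun h => by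
      have := congrArg (fun f => f (Pi.single ω (1 : ℝ))) h
      simp [expUtilₗ, expUtil, Pi.single_apply, sub_eq_zero] at this
      exact hω this
    have hopen : IsOpenMap (expUtilₗ G.u a - expUtilₗ G.u b) :=
      LinearMap.isOpenMap_of_finiteDimensional _ (LinearMap.surjective_of_ne_zero hne)
    convert (dense_compl_singleton (0 : ℝ)).preimage hopen using 1
    ext x
    simp [expUtilₗ, sub_eq_zero]
  have hRT : {x | ∀ ω, 0 < x ω} ∩ R ⊆ T := by
    rintro x ⟨hx, hxR⟩
    obtain ⟨a, ha⟩ := optA_nonempty G.u x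
    refine Set.mem_biUnion (x := a) (G.propU2_of_eventually hx ?_) ha
    simp only [mem_optA, eventually_all]
    intro b
    by_cases hb : ∃ ω, G.u b ω ≠ G.u a ω
    · have hlt : expUtil G.u b x < expUtil G.u a x :=
        lt_of_le_of_ne (mem_optA.1 ha b) (Set.mem_iInter.1 hxR ⟨(b, a), hb⟩)
      exact (((hcont b).tendsto x).eventually_lt ((hcont a).tendsto x) hlt).mono fun _ h => h.le
    · push Not at hb
      exact Eventually.of_forall fun y => (expUtil_congr hb y).le
  have hμcl : μ ∈ closure {x : Ω → ℝ | ∀ ω, 0 < x ω} := by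
    have hlim : Tendsto (fun s : ℝ => fun ω => μ ω + s) (𝓝[>] 0) (𝓝 μ) := by
      have : Continuous fun s : ℝ => fun ω => μ ω + s := by fun_prop
      simpa using (this.tendsto 0).mono_left nhdsWithin_le_nhds
    exact mem_closure_of_tendsto hlim (by
      filter_upwards [self_mem_nhdsWithin] with s hs ω
      exact add_pos_of_nonneg_of_pos (hμ ω) hs)
  have hμT : μ ∈ T := closure_minimal
    ((hR.open_subset_closure_inter isOpen_pos).trans (closure_minimal hRT hT)) hT hμcl
  obtain ⟨a, ha, hμa⟩ := Set.mem_iUnion₂.1 hμT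
  exact ⟨a, ha, hμa⟩

/-- If another action ties with `a` throughout a full-dimensional best-reply region, then it is
a duplicate of `a`. Nonemptiness matters: for a single state the empty region has
dimension `|Ω| - 1` in the sense of `PropU2`. -/
lemma exists_expUtil_lt {G : BPModel Ω A} {a b : A} (ha : G.PropU2 a)
    (hne : (bestReplyRegion G.u a).Nonempty) (hb : ∃ ω, G.u b ω ≠ G.u a ω) :
    ∃ ν ∈ bestReplyRegion G.u a, expUtil G.u b ν < expUtil G.u a ν := by
  classical
  by_contra! hcon
  have heq : ∀ ν ∈ bestReplyRegion G.u a, expUtil G.u b ν = expUtil G.u a ν := fun ν hν =>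
    le_antisymm (mem_optA.1 hν.2 b) (hcon ν hν)
  have hle : LinearMap.ker (mass Ω) ≤ LinearMap.ker (expUtilₗ G.u b - expUtilₗ G.u a) := by
    rw [← (G.propU2_iff a).1 ha, vectorSpan, Submodule.span_le]
    rintro _ ⟨x, hx, y, hy, rfl⟩
    have hx' : expUtilₗ G.u b x = expUtilₗ G.u a x := heq x hx
    have hy' : expUtilₗ G.u b y = expUtilₗ G.u a y := heq y hy
    simp [hx', hy']
  obtain ⟨ν, hν⟩ := hne
  obtain ⟨ω, hω⟩ := hb
  have hmem : Pi.single ω (1 : ℝ) - ν ∈ LinearMap.ker (mass Ω) := by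
    simp [mass_apply, hν.1.2]
  have h := hle hmem
  have hν' : expUtilₗ G.u b ν = expUtilₗ G.u a ν := heq ν hν
  rw [LinearMap.mem_ker, map_sub, LinearMap.sub_apply, LinearMap.sub_apply, hν', sub_self,
    sub_zero, sub_eq_zero] at h
  exact hω (by simpa [expUtilₗ, expUtil, Pi.single_apply] using h)

/-- A nonempty full-dimensional best-reply region contains a belief at which only duplicates of
the action tie with it: average the beliefs that separate it from the others. -/
lemma exists_strict_belief {G : BPModel Ω A} {a : A} (ha : G.PropU2 a)
    (hne : (bestReplyRegion G.u a).Nonempty) :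
    ∃ ν ∈ stdSimplex ℝ Ω, ∀ b, (∃ ω, G.u b ω ≠ G.u a ω) →
      expUtil G.u b ν < expUtil G.u a ν := by
  have hg : ∀ b, ∃ ν ∈ bestReplyRegion G.u a, (∃ ω, G.u b ω ≠ G.u a ω) →
      expUtil G.u b ν < expUtil G.u a ν := fun b => by
    by_cases hb : ∃ ω, G.u b ω ≠ G.u a ω
    · obtain ⟨ν, hν, hlt⟩ := exists_expUtil_lt ha hne hb
      exact ⟨ν, hν, fun _ => hlt⟩
    · exact ⟨hne.some, hne.some_mem, fun h => absurd h hb⟩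
  choose g hgm hg using hg
  have hcard : (0 : ℝ) < Fintype.card A := by
    exact_mod_cast Fintype.card_pos_iff.2 ⟨a⟩
  refine ⟨∑ b, (Fintype.card A : ℝ)⁻¹ • g b, (convex_stdSimplex ℝ Ω).sum_mem
    (fun _ _ => inv_nonneg.2 hcard.le) (by simp [hcard.ne']) fun b _ => (hgm b).1, fun b hb => ?_⟩
  simp only [expUtil_sum, expUtil_smul]
  exact Finset.sum_lt_sum
    (fun c _ => mul_le_mul_of_nonneg_left (mem_optA.1 (hgm c).2 b) (inv_nonneg.2 hcard.le))
    ⟨b, Finset.mem_univ b, mul_lt_mul_of_pos_left (hg b hb) (inv_pos.2 hcard)⟩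

/-! ### Reducing the number of messages -/

/-- Carathéodory's theorem for cones, keeping a linear objective from decreasing. The weights
move along a linear relation between the points in the support, in the direction in which the
objective does not decrease. As the points have total mass one, the coefficients of the relation
sum to zero, so some weight decreases and the support eventually shrinks. -/
lemma exists_small_support {N : Type*} [Fintype N] (p : N → Ω → ℝ)
    (hp : ∀ i, p i ∈ stdSimplex ℝ Ω) (f w : N → ℝ) (hw : ∀ i, 0 ≤ w i) :
    ∃ w' : N → ℝ, (∀ i, 0 ≤ w' i) ∧ ∑ i, w' i • p i = ∑ i, w i • p i ∧
      ∑ i, w i * f i ≤ ∑ i, w' i * f i ∧ Nat.card {i // w' i ≠ 0} ≤ Fintype.card Ω := by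
  classical
  induction hn : Nat.card {i // w i ≠ 0} using Nat.strong_induction_on generalizing w with
  | _ n ih =>
  by_cases hcard : n ≤ Fintype.card Ω
  · exact ⟨w, hw, rfl, le_rfl, hn ▸ hcard⟩
  have hdep : ¬ LinearIndependent ℝ fun i : {i // w i ≠ 0} => p i := fun h => by
    have := h.fintype_card_le_finrank
    rw [Module.finrank_fintype_fun_eq_card, ← Nat.card_eq_fintype_card, hn] at this
    exact hcard this
  obtain ⟨c, hc, hcs, hcf, j, hj⟩ : ∃ c : N → ℝ, ∑ i, c i • p i = 0 ∧
      (∀ i, w i = 0 → c i = 0) ∧ 0 ≤ ∑ i, c i * f i ∧ ∃ j, c j ≠ 0 := by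
    rw [Fintype.not_linearIndependent_iff] at hdep
    obtain ⟨g, hg, j, hj⟩ := hdep
    let c : N → ℝ := fun i => if h : w i ≠ 0 then g ⟨i, h⟩ else 0
    have hc : ∑ i, c i • p i = 0 := by
      rw [← hg]
      refine (Fintype.sum_of_injective _ Subtype.val_injective _ _ (fun i hi => ?_)
        fun i => ?_).symm
      · have : ¬ w i ≠ 0 := fun h => hi ⟨⟨i, h⟩, rfl⟩
        simp [c, this]
      · simp [c, i.2]
    have hcs : ∀ i, w i = 0 → c i = 0 := fun i hi => by simp [c, hi]
    have hcj : c j ≠ 0 := by simpa [c, j.2] using hj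
    rcases le_total 0 (∑ i, c i * f i) with h | h
    · exact ⟨c, hc, hcs, h, j, hcj⟩
    · exact ⟨-c, by simp [hc], fun i hi => by simp [hcs i hi], by simpa using h, j, by simpa⟩
  have hsum : ∑ i, c i = 0 := by
    have h := congrArg (mass Ω) hc
    simpa [mass_apply, ← Finset.mul_sum, (hp _).2] using h
  obtain ⟨k, hk⟩ : ∃ k, c k < 0 := by
    by_contra! hcon
    exact hj ((Finset.sum_eq_zero_iff_of_nonneg fun i _ => hcon i).1 hsum j (Finset.mem_univ j))
  -- The first weight to vanish in the direction `c`.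
  obtain ⟨l, hl, hmin⟩ := (Finset.univ.filter fun i => c i < 0).exists_min_image
    (fun i => w i / -c i) ⟨k, by simpa using hk⟩
  have hl : c l < 0 := by simpa using hl
  set τ := w l / -c l with hτ
  have hτ0 : 0 ≤ τ := div_nonneg (hw l) (by linarith)
  have hw' : ∀ i, 0 ≤ w i + τ * c i := fun i => by
    rcases le_or_gt 0 (c i) with h | h
    · exact add_nonneg (hw i) (mul_nonneg hτ0 h)
    · have := hmin i (by simpa using h)
      rw [le_div_iff₀ (by linarith)] at this
      linarith
  have hl0 : w l + τ * c l = 0 := by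
    rw [hτ, div_neg, neg_mul, div_mul_cancel₀ _ hl.ne, add_neg_cancel]
  have hlt : Nat.card {i // w i + τ * c i ≠ 0} < n := by
    rw [← hn, Nat.card_eq_fintype_card, Nat.card_eq_fintype_card]
    refine Fintype.card_lt_of_injective_of_notMem
      (fun i => ⟨i.1, fun h => i.2 (by simp [h, hcs _ h])⟩) (fun i i' h => ?_)
      (b := ⟨l, fun h => hl.ne (hcs l h)⟩) ?_
    · exact Subtype.ext (congrArg (fun q => q.1) h)
    · rintro ⟨i, hi⟩
      exact i.2 (by rw [congrArg (fun q => q.1) hi]; exact hl0)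
  obtain ⟨w', h₀, h₁, h₂, h₃⟩ := ih _ hlt _ hw' rfl
  refine ⟨w', h₀, h₁.trans ?_, le_trans ?_ h₂, h₃⟩
  · simp only [add_smul, mul_smul, Finset.sum_add_distrib, ← Finset.smul_sum, hc, smul_zero,
      add_zero]
  · simp only [add_mul, mul_assoc, Finset.sum_add_distrib, ← Finset.mul_sum]
    exact le_add_of_nonneg_right (mul_nonneg hτ0 hcf)

/-- A splitting of the prior into any finite number of posteriors can be replaced by a policy
with messages in `M` without lowering the expectation of a given function `f` of the index. The
bound for `h` is uniform: one policy serves all functions `h` of the belief that dominate `f`. -/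
lemma exists_policy_of_splitting (G : BPModel Ω A) {M : Type*} [Fintype M]
    (hM : Fintype.card Ω ≤ Fintype.card M) {N : Type*} [Fintype N] (p : N → Ω → ℝ)
    (hp : ∀ i, p i ∈ stdSimplex ℝ Ω) (f w : N → ℝ) (hw : ∀ i, 0 ≤ w i)
    (hsplit : ∑ i, w i • p i = G.prior) :
    ∃ π : G.Policy M, ∀ h : (Ω → ℝ) → ℝ, (∀ i, f i ≤ h (p i)) →
      ∑ i, w i * f i ≤ ∑ m, π.weight m * h (π.posterior m) := by
  classical
  obtain ⟨w', hw', hsum, hf, hcard⟩ := exists_small_support p hp f w hw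
  rw [hsplit] at hsum
  rw [Nat.card_eq_fintype_card] at hcard
  obtain ⟨e⟩ := Function.Embedding.nonempty_of_card_le (hcard.trans hM)
  let W : M → ℝ := Function.extend e (fun i => w' i) 0
  let P : M → Ω → ℝ := Function.extend e (fun i => p i) fun _ => G.prior
  have hWe : ∀ i, W (e i) = w' i := fun i => e.injective.extend_apply _ _ i
  have hPe : ∀ i, P (e i) = p i := fun i => e.injective.extend_apply _ _ i
  have key : ∀ g : (Ω → ℝ) → ℝ, ∑ m, W m * g (P m) = ∑ i, w' i * g (p i) := fun g => by
    have h₁ : ∑ i : {i // w' i ≠ 0}, w' i * g (p i) = ∑ m, W m * g (P m) :=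
      Fintype.sum_of_injective e e.injective _ _
        (fun m hm => by
          have : W m = 0 := Function.extend_apply' _ _ _ (by simpa using hm)
          simp [this])
        fun i => by rw [hWe, hPe]
    have h₂ : ∑ i : {i // w' i ≠ 0}, w' i * g (p i) = ∑ i, w' i * g (p i) :=
      Fintype.sum_of_injective _ Subtype.val_injective _ _
        (fun i hi => by
          have : w' i = 0 := by
            by_contra h
            exact hi ⟨⟨i, h⟩, rfl⟩
          simp [this])
        fun i => rfl
    rw [← h₁, h₂]
  have hP : ∀ m, P m ∈ stdSimplex ℝ Ω := fun m => by
    by_cases hm : ∃ i, e i = m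
    · obtain ⟨i, rfl⟩ := hm
      rw [hPe]; exact hp i
    · have : P m = G.prior := Function.extend_apply' _ _ _ hm
      rw [this]; exact G.prior_mem
  have hW : ∀ m, 0 ≤ W m := fun m => by
    by_cases hm : ∃ i, e i = m
    · obtain ⟨i, rfl⟩ := hm
      rw [hWe]; exact hw' i
    · exact (Function.extend_apply' _ _ _ hm : W m = 0).ge
  refine ⟨⟨W, P, ⟨hW, ?_⟩, hP, fun ω => ?_⟩, fun h hh => hf.trans ?_⟩
  · have h := congrArg (mass Ω) hsum
    simp only [mass_apply, map_sum, map_smul, (hp _).2, G.prior_mem.2, smul_eq_mul] at h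
    have h' := key fun _ => 1
    simp only [mul_one] at h' h
    exact h'.trans h
  · rw [key fun x => x ω, ← hsum]
    simp
  · change _ ≤ ∑ m, W m * h (P m)
    rw [key h]
    exact Finset.sum_le_sum fun i _ => mul_le_mul_of_nonneg_left (hh i) (hw' i)

end

/-! ### A stable policy yields a policy that is good for all nearby types -/

section

variable {Ω A : Type*} [Fintype Ω] [Fintype A]

lemma PropU1.propU1S {G : BPModel Ω A} {a : A} (h : G.PropU1 a) (μ : Ω → ℝ) :
    G.PropU1S μ a := fun b hb => by
  by_cases hba : b = a
  · rw [hba]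
  · obtain ⟨ω, hω⟩ := h b hba
    exact absurd (hb ω).symm hω

variable [Nonempty A] (G : BPModel Ω A)

/-- At a belief moved slightly towards one where only duplicates of `a` are best replies, all
nearby types choose a duplicate of `a`, and the sender loses little. -/
lemma exists_perturbed_belief {G : BPModel Ω A} {μ : Ω → ℝ} (hμ : μ ∈ stdSimplex ℝ Ω) {a : A}
    (ha : G.Induced G.u μ a) (hU1 : G.PropU1S μ a) (hU2 : G.PropU2 a) {t : ℝ} (ht : 0 < t)
    (ht1 : t ≤ 1) :
    ∃ ν ∈ stdSimplex ℝ Ω, ∀ᶠ θ in 𝓝 G.u,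
      G.indirect G.u μ - t ≤ G.indirect θ ((1 - t) • μ + t • ν) := by
  obtain ⟨ν, hν, hstrict⟩ := exists_strict_belief hU2 ⟨μ, hμ, ha.1⟩
  refine ⟨ν, hν, ?_⟩
  set p := (1 - t) • μ + t • ν with hpdef
  have hp : ∀ (w : A → Ω → ℝ) b, expUtil w b p = (1 - t) * expUtil w b μ + t * expUtil w b ν :=
    fun w b => by rw [hpdef, expUtil_add, expUtil_smul, expUtil_smul]
  have hev : ∀ᶠ θ in 𝓝 G.u, ∀ b, (∃ ω, G.u b ω ≠ G.u a ω) →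
      expUtil θ b p < expUtil θ a p := by
    refine eventually_all.2 fun b => ?_
    by_cases hb : ∃ ω, G.u b ω ≠ G.u a ω
    · have hlt : expUtil G.u b p < expUtil G.u a p := by
        rw [hp, hp]
        exact add_lt_add_of_le_of_lt
          (mul_le_mul_of_nonneg_left (mem_optA.1 ha.1 b) (sub_nonneg.2 ht1))
          (mul_lt_mul_of_pos_left (hstrict b hb) ht)
      have hcont : ∀ c : A, Continuous fun θ : A → Ω → ℝ => expUtil θ c p := fun c =>
        (continuous_expUtil c).comp (Continuous.prodMk_left p)
      exact (((hcont b).tendsto G.u).eventually_lt ((hcont a).tendsto G.u) hlt).mono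
        fun _ h _ => h
    · exact Eventually.of_forall fun _ h => absurd h hb
  filter_upwards [hev] with θ hθ
  obtain ⟨c, hc⟩ := G.exists_induced θ p
  have hdup : ∀ ω, G.u c ω = G.u a ω := by
    by_contra! h
    exact (hθ c h).not_ge (mem_optA.1 hc.1 a)
  rw [hc.indirect_eq, ha.indirect_eq, hp, hU1 c hdup]
  nlinarith [(expUtil_mem_Icc G.v_mem c hν).1, (expUtil_mem_Icc G.v_mem a hμ).2]

lemma exists_policy_eventually_ge {M : Type*} [Fintype M]
    (hM : Fintype.card Ω ≤ Fintype.card M) (h : G.StablePolicyCondition M) {ε : ℝ}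
    (hε : 0 < ε) :
    ∃ π : G.Policy M, ∀ᶠ θ in 𝓝 G.u, G.optValue M G.u - ε ≤ G.Ev θ π := by
  classical
  have := G.nonempty_states
  obtain ⟨π, hopt, hπ⟩ := h
  have hV : G.optValue M G.u = G.Ev G.u π :=
    le_antisymm (by have : Nonempty (G.Policy M) := ⟨π⟩; exact ciSup_le hopt)
      (G.Ev_le_optValue G.u π)
  obtain ⟨ω₀, -, hω₀⟩ := Finset.exists_min_image Finset.univ G.prior Finset.univ_nonempty
  set c := G.prior ω₀ with hc
  have hc0 : 0 < c := G.prior_pos ω₀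
  have hc1 : c ≤ 1 := by
    rw [← G.prior_mem.2]
    exact Finset.single_le_sum (fun ω _ => (G.prior_pos ω).le) (Finset.mem_univ ω₀)
  set s := min (ε / 2) 1 with hs
  have hs0 : 0 < s := lt_min (half_pos hε) one_pos
  have hs1 : s ≤ 1 := min_le_right _ _
  have hsε : s ≤ ε / 2 := min_le_left _ _
  -- The shift `t` is so small that a fraction `1 - s` of the shifted splitting lies below the
  -- prior.
  set t := s * c with ht
  have ht0 : 0 < t := mul_pos hs0 hc0
  have hts : t ≤ s := mul_le_of_le_one_right hs0.le hc1
  have hm : ∀ m, ∃ ν ∈ stdSimplex ℝ Ω, ∃ f : ℝ,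
      π.weight m * (G.indirect G.u (π.posterior m) - t) ≤ π.weight m * f ∧
      ∀ᶠ θ in 𝓝 G.u, f ≤ G.indirect θ ((1 - t) • π.posterior m + t • ν) := fun m => by
    rcases (π.weight_mem.1 m).eq_or_lt with h | h
    · refine ⟨π.posterior m, π.posterior_mem m, 0, by simp [← h], Eventually.of_forall fun θ => ?_⟩
      rw [← add_smul, sub_add_cancel, one_smul]
      exact (G.indirect_mem_Icc θ (π.posterior_mem m)).1
    · obtain ⟨a, ha, hU1, hU2⟩ := hπ m h
      obtain ⟨ν, hν, hev⟩ := exists_perturbed_belief (π.posterior_mem m) ha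
        (hU1.elim (fun h => h.propU1S _) id) hU2 ht0 (hts.trans hs1)
      exact ⟨ν, hν, _, le_rfl, hev⟩
  choose ν hν f hf hev using hm
  set q : M → Ω → ℝ := fun m => (1 - t) • π.posterior m + t • ν m with hq
  have hqmem : ∀ m, q m ∈ stdSimplex ℝ Ω := fun m =>
    convex_stdSimplex ℝ Ω (π.posterior_mem m) (hν m) (by linarith) ht0.le (by ring)
  -- The rest of the prior is split into point masses.
  set r : Ω → ℝ := fun ω => G.prior ω - ∑ m, (1 - s) * π.weight m * q m ω with hr
  have hr0 : ∀ ω, 0 ≤ r ω := fun ω => by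
    have h₁ : ∑ m, π.weight m * ν m ω ≤ 1 := by
      rw [← π.weight_mem.2]
      refine Finset.sum_le_sum fun m _ => mul_le_of_le_one_right (π.weight_mem.1 m) ?_
      rw [← (hν m).2]
      exact Finset.single_le_sum (fun ω _ => (hν m).1 ω) (Finset.mem_univ ω)
    have h₂ : ∑ m, (1 - s) * π.weight m * q m ω =
        (1 - s) * ((1 - t) * G.prior ω + t * ∑ m, π.weight m * ν m ω) := by
      rw [← π.splits ω]
      simp only [Finset.mul_sum, ← Finset.sum_add_distrib, hq, Pi.add_apply, Pi.smul_apply,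
        smul_eq_mul]
      exact Finset.sum_congr rfl fun m _ => by ring
    have h₃ : (1 - t) * G.prior ω + t * ∑ m, π.weight m * ν m ω ≤ G.prior ω + t := by
      nlinarith [mul_pos ht0 (G.prior_pos ω), mul_le_mul_of_nonneg_left h₁ ht0.le]
    have h₄ := mul_le_mul_of_nonneg_left h₃ (sub_nonneg.2 hs1)
    have h₅ := mul_le_mul_of_nonneg_left (hω₀ ω (Finset.mem_univ ω)) hs0.le
    have h₆ : 0 ≤ s * t := mul_nonneg hs0.le ht0.le
    simp only [hr, h₂]
    nlinarith
  obtain ⟨σ, hσ⟩ := G.exists_policy_of_splitting hM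
    (Sum.elim q fun ω => Pi.single ω (1 : ℝ))
    (by rintro (m | ω); exacts [hqmem m, single_mem_stdSimplex ℝ ω])
    (Sum.elim f fun _ => 0) (Sum.elim (fun m => (1 - s) * π.weight m) r)
    (by rintro (m | ω); exacts [mul_nonneg (sub_nonneg.2 hs1) (π.weight_mem.1 m), hr0 ω])
    (by
      ext ω
      simp [Fintype.sum_sum_type, Finset.sum_apply, Pi.single_apply, hr])
  refine ⟨σ, ?_⟩
  filter_upwards [eventually_all.2 hev] with θ hθ
  refine le_trans ?_ (hσ (G.indirect θ) ?_)
  · simp only [Fintype.sum_sum_type, Sum.elim_inl, Sum.elim_inr, mul_zero, Finset.sum_const_zero,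
      add_zero]
    have h₁ : G.optValue M G.u - t ≤ ∑ m, π.weight m * f m := by
      refine le_trans (le_of_eq ?_) (Finset.sum_le_sum fun m _ => hf m)
      simp only [mul_sub, Finset.sum_sub_distrib, ← Finset.sum_mul, π.weight_mem.2, one_mul]
      rw [hV, Ev]
    have h₂ := mul_le_mul_of_nonneg_left h₁ (sub_nonneg.2 hs1)
    simp only [mul_assoc, ← Finset.mul_sum]
    nlinarith [(G.optValue_mem_Icc M G.u).2]
  · rintro (m | ω)
    · exact hθ m
    · exact (G.indirect_mem_Icc θ (single_mem_stdSimplex ℝ ω)).1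

end

/-! ### Adverse types -/

section

variable {Ω A : Type*} [Fintype Ω] [Fintype A]

open Classical in
/-- A type close to `G.u` that never takes an action with a lower-dimensional best-reply region
and breaks ties between duplicates against the sender. The penalty `2` on lower-dimensional
actions outweighs the penalty `G.v ≤ 1` on the others. -/
noncomputable def adverseType (G : BPModel Ω A) (t : ℝ) : A → Ω → ℝ := fun a ω =>
  G.u a ω - t * if G.PropU2 a then G.v a ω else 2

lemma expUtil_adverseType_of_propU2 {G : BPModel Ω A} {a : A} (ha : G.PropU2 a) (t : ℝ)
    (μ : Ω → ℝ) :
    expUtil (G.adverseType t) a μ = expUtil G.u a μ - t * expUtil G.v a μ := by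
  simp only [expUtil, adverseType, if_pos ha, mul_sub, Finset.sum_sub_distrib, Finset.mul_sum,
    mul_left_comm]

lemma expUtil_adverseType_of_not_propU2 {G : BPModel Ω A} {a : A} (ha : ¬ G.PropU2 a) (t : ℝ)
    {μ : Ω → ℝ} (hμ : μ ∈ stdSimplex ℝ Ω) :
    expUtil (G.adverseType t) a μ = expUtil G.u a μ - t * 2 := by
  simp only [expUtil, adverseType, if_neg ha, mul_sub, Finset.sum_sub_distrib, ← Finset.sum_mul,
    hμ.2, one_mul]

lemma tendsto_adverseType (G : BPModel Ω A) : Tendsto G.adverseType (𝓝 0) (𝓝 G.u) := by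
  have h : Continuous G.adverseType := by
    unfold adverseType
    fun_prop
  have h₀ : G.adverseType 0 = G.u := by
    ext a ω
    simp [adverseType]
  simpa [h₀] using h.tendsto 0

lemma bestReplyRegion_congr {G : BPModel Ω A} {a b : A} (h : ∀ ω, G.u b ω = G.u a ω) :
    bestReplyRegion G.u b = bestReplyRegion G.u a := by
  ext μ
  simp only [bestReplyRegion, Set.mem_ofPred_eq, mem_optA, expUtil_congr h μ]

lemma propU2_and_le_of_mem_optA_adverseType [Nonempty A] {G : BPModel Ω A} {t : ℝ} (ht : 0 < t)
    {μ : Ω → ℝ} (hμ : μ ∈ stdSimplex ℝ Ω) {a : A} (ha : a ∈ optA (G.adverseType t) μ) :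
    G.PropU2 a ∧ ∀ b, (∀ ω, G.u b ω = G.u a ω) → expUtil G.v a μ ≤ expUtil G.v b μ := by
  rw [mem_optA] at ha
  have hU2 : G.PropU2 a := by
    by_contra hcon
    obtain ⟨b, hb, hbμ⟩ := G.exists_propU2_mem_optA hμ.1
    have h := ha b
    rw [expUtil_adverseType_of_propU2 hb, expUtil_adverseType_of_not_propU2 hcon t hμ] at h
    nlinarith [mem_optA.1 hbμ a, (expUtil_mem_Icc G.v_mem b hμ).2]
  refine ⟨hU2, fun b hb => ?_⟩
  have hbU2 : G.PropU2 b := by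
    rw [PropU2, bestReplyRegion_congr hb]
    exact hU2
  have h := ha b
  rw [expUtil_adverseType_of_propU2 hU2, expUtil_adverseType_of_propU2 hbU2,
    expUtil_congr hb μ] at h
  exact le_of_mul_le_mul_left (by linarith) ht

lemma dist_lt_of_mem_typeSpace {G : BPModel Ω A} {lo : A → Ω → ℝ} {δ r : ℝ} (hr : 0 < r)
    (hδ : δ < r) (hlo : Wraps lo δ G) {θ : A → Ω → ℝ} (hθ : θ ∈ typeSpace lo δ) :
    dist θ G.u < r := by
  refine (dist_pi_lt_iff hr).2 fun a => (dist_pi_lt_iff hr).2 fun ω => ?_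
  obtain ⟨h₁, h₂⟩ := hlo a ω
  obtain ⟨h₃, h₄⟩ := hθ a ω
  rw [Real.dist_eq, abs_lt]
  constructor <;> linarith

lemma Wraps.mem_typeSpace {G : BPModel Ω A} {lo : A → Ω → ℝ} {δ : ℝ} (hlo : Wraps lo δ G) :
    G.u ∈ typeSpace lo δ := fun a ω => Set.Ioo_subset_Icc_self (hlo a ω)

variable [Nonempty A] (G : BPModel Ω A) {M : Type*} [Fintype M]

/-- If policies against adverse types approach the value at `G.u`, then a limit of such policies
is stable. The actions used along the way are full-dimensional and worst for the sender among
their duplicates; since no value is lost in the limit, they are also best for the sender among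
all best replies, so that all duplicates are equivalent. -/
lemma stablePolicyCondition_of_adverseType
    (h : ∀ ε > 0, ∀ η > 0, ∃ t, 0 < t ∧ t < η ∧
      ∃ π : G.Policy M, G.optValue M G.u - ε < G.Ev (G.adverseType t) π) :
    G.StablePolicyCondition M := by
  have hpos : ∀ n : ℕ, (0 : ℝ) < 1 / ((n : ℝ) + 1) := fun n => Nat.one_div_pos_of_nat
  choose t ht htn π hπ using fun n : ℕ => h _ (hpos n) _ (hpos n)
  have hlim₀ : Tendsto (fun n : ℕ => 1 / ((n : ℝ) + 1)) (hyperfilter ℕ) (𝓝 0) :=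
    tendsto_one_div_add_atTop_nhds_zero_nat.mono_left Nat.hyperfilter_le_atTop
  have htlim : Tendsto t (hyperfilter ℕ) (𝓝 0) :=
    tendsto_of_tendsto_of_tendsto_of_le_of_le tendsto_const_nhds hlim₀ (fun n => (ht n).le)
      fun n => (htn n).le
  obtain ⟨ρ, hw, hp⟩ := G.exists_policy_tendsto (hyperfilter ℕ) π
  obtain ⟨a, hind, hopt, hEv⟩ := G.exists_actions_tendsto (hyperfilter ℕ) hw hp
    (G.tendsto_adverseType.comp htlim)
  have hV : G.optValue M G.u ≤ ∑ m, ρ.weight m * expUtil G.v (a m) (ρ.posterior m) := by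
    have h₀ := hlim₀.const_sub (G.optValue M G.u)
    rw [sub_zero] at h₀
    exact le_of_tendsto_of_tendsto h₀ hEv (Eventually.of_forall fun n => (hπ n).le)
  have hle := G.sum_expUtil_le_Ev ρ hopt
  have hEq : ∑ m, ρ.weight m * expUtil G.v (a m) (ρ.posterior m) = G.Ev G.u ρ :=
    le_antisymm hle ((G.Ev_le_optValue G.u ρ).trans hV)
  refine ⟨ρ, fun π' => (G.Ev_le_optValue G.u π').trans (hV.trans hle), fun m hm => ?_⟩
  have hterm := (Finset.sum_eq_sum_iff_of_le fun m _ => mul_le_mul_of_nonneg_left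
    (G.le_indirect (hopt m)) (ρ.weight_mem.1 m)).1 hEq m (Finset.mem_univ m)
  have hbest : expUtil G.v (a m) (ρ.posterior m) = G.indirect G.u (ρ.posterior m) :=
    mul_left_cancel₀ hm.ne' hterm
  have hInd : G.Induced G.u (ρ.posterior m) (a m) :=
    ⟨hopt m, fun b hb => hbest ▸ G.le_indirect hb⟩
  have hadv : ∀ᶠ n in (hyperfilter ℕ : Filter ℕ), G.PropU2 (a m) ∧
      ∀ b, (∀ ω, G.u b ω = G.u (a m) ω) →
        expUtil G.v (a m) ((π n).posterior m) ≤ expUtil G.v b ((π n).posterior m) :=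
    hind.mono fun n hn =>
      propU2_and_le_of_mem_optA_adverseType (ht n) ((π n).posterior_mem m) (hn m).1
  have hcont : ∀ b, Tendsto (fun n => expUtil G.v b ((π n).posterior m)) (hyperfilter ℕ)
      (𝓝 (expUtil G.v b (ρ.posterior m))) := fun b =>
    ((continuous_expUtil b).tendsto (G.v, ρ.posterior m)).comp
      (tendsto_const_nhds.prodMk_nhds (hp m))
  refine ⟨a m, hInd, Or.inr fun b hb => le_antisymm (hInd.2 b ?_) ?_, hadv.exists.choose_spec.1⟩
  · exact mem_optA.2 fun c => by
      rw [expUtil_congr hb]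
      exact mem_optA.1 (hopt m) c
  · exact le_of_tendsto_of_tendsto (hcont _) (hcont _) (hadv.mono fun n hn => hn.2 b hb)

/-! ### Comparison of the four conditions -/

/-- It suffices that in each small interval model around `G.u` every type has a policy that
gives the sender almost the value at `G.u`. -/
lemma stablePolicyCondition_of_typeSpace
    (h : ∀ ε > 0, ∃ δ₀ > 0, ∀ δ < δ₀, ∀ lo : A → Ω → ℝ, Wraps lo δ G → ∀ θ ∈ typeSpace lo δ,
      ∃ π : G.Policy M, G.optValue M G.u - ε < G.Ev θ π) :
    G.StablePolicyCondition M := by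
  refine G.stablePolicyCondition_of_adverseType fun ε hε η hη => ?_
  obtain ⟨δ₀, hδ₀, h⟩ := h ε hε
  obtain ⟨t, ht0, ht⟩ := exists_between (lt_min hη (div_pos hδ₀ (by norm_num : (0 : ℝ) < 4)))
  obtain ⟨htη, htδ⟩ := lt_min_iff.1 ht
  refine ⟨t, ht0, htη, h (4 * t) (by linarith) (fun a ω => G.u a ω - 3 * t) (fun a ω => ?_) _
    fun a ω => ?_⟩
  · constructor <;> linarith
  · have hv := G.v_mem a ω
    have h₁ := mul_nonneg ht0.le hv.1
    have h₂ := mul_le_mul_of_nonneg_left hv.2 ht0.le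
    unfold adverseType
    split_ifs <;> constructor <;> linarith

variable {G}

lemma IsContinuous.stablePolicyCondition [Nonempty M] (h : G.IsContinuous M) :
    G.StablePolicyCondition M := by
  have := G.nonempty_policy (M := M)
  refine G.stablePolicyCondition_of_typeSpace fun ε hε => ?_
  obtain ⟨δ₀, hδ₀, h⟩ := h ε hε
  refine ⟨δ₀, hδ₀, fun δ hδ lo hlo θ hθ => exists_lt_of_lt_ciSup ?_⟩
  change _ < G.optValue M θ
  linarith [(abs_lt.1 (h δ hδ lo hlo θ hθ)).1]

lemma RobustMaxMin.stablePolicyCondition [Nonempty M] (h : G.RobustMaxMin M) :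
    G.StablePolicyCondition M := by
  refine G.stablePolicyCondition_of_typeSpace fun ε hε => ?_
  obtain ⟨δ₀, hδ₀, h⟩ := h ε hε
  refine ⟨δ₀, hδ₀, fun δ hδ lo hlo θ hθ => ?_⟩
  obtain ⟨π, hπ⟩ := G.exists_isMaxMin (M := M) ⟨G.u, hlo.mem_typeSpace⟩
  exact ⟨π, by linarith [(abs_lt.1 (h δ hδ lo hlo θ hθ π hπ)).1]⟩

lemma RobustRegret.stablePolicyCondition [Nonempty M] (h : G.RobustRegret M) :
    G.StablePolicyCondition M := by
  refine G.stablePolicyCondition_of_typeSpace fun ε hε => ?_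
  obtain ⟨δ₀, hδ₀, h⟩ := h ε hε
  refine ⟨δ₀, hδ₀, fun δ hδ lo hlo θ hθ => ?_⟩
  obtain ⟨π, hπ⟩ := G.exists_isRegretMinimizing (M := M) ⟨G.u, hlo.mem_typeSpace⟩
  exact ⟨π, by linarith [(abs_lt.1 (h δ hδ lo hlo θ hθ π hπ)).1]⟩

/-- Under the stability condition one policy is almost optimal against all types in all small
interval models, and no type in them allows much more than the value at `G.u`. -/
lemma StablePolicyCondition.exists_uniform_policy [Nonempty M]
    (hM : Fintype.card Ω ≤ Fintype.card M) (h : G.StablePolicyCondition M) {ε : ℝ}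
    (hε : 0 < ε) :
    ∃ π : G.Policy M, ∃ δ₀ > 0, ∀ δ < δ₀, ∀ lo : A → Ω → ℝ, Wraps lo δ G →
      ∀ θ ∈ typeSpace lo δ, G.optValue M G.u - ε ≤ G.Ev θ π ∧
        G.optValue M θ < G.optValue M G.u + ε := by
  obtain ⟨π, hπ⟩ := G.exists_policy_eventually_ge hM h hε
  obtain ⟨r, hr, hball⟩ :=
    Metric.eventually_nhds_iff.1 (hπ.and (G.eventually_optValue_lt (M := M) G.u hε))
  exact ⟨π, r, hr, fun δ hδ lo hlo θ hθ => hball (dist_lt_of_mem_typeSpace hr hδ hlo hθ)⟩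

lemma StablePolicyCondition.isContinuous [Nonempty M] (hM : Fintype.card Ω ≤ Fintype.card M)
    (h : G.StablePolicyCondition M) : G.IsContinuous M := by
  intro ε hε
  obtain ⟨π, δ₀, hδ₀, hπ⟩ := h.exists_uniform_policy hM (half_pos hε)
  refine ⟨δ₀, hδ₀, fun δ hδ lo hlo θ hθ => abs_lt.2 ?_⟩
  obtain ⟨h₁, h₂⟩ := hπ δ hδ lo hlo θ hθ
  constructor <;> linarith [G.Ev_le_optValue θ π]

lemma StablePolicyCondition.robustMaxMin [Nonempty M] (hM : Fintype.card Ω ≤ Fintype.card M)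
    (h : G.StablePolicyCondition M) : G.RobustMaxMin M := by
  intro ε hε
  obtain ⟨π, δ₀, hδ₀, hπ⟩ := h.exists_uniform_policy hM (half_pos hε)
  refine ⟨δ₀, hδ₀, fun δ hδ lo hlo θ hθ ρ hρ => abs_lt.2 ?_⟩
  have : Nonempty (typeSpace lo δ) := ⟨⟨θ, hθ⟩⟩
  have h₁ : G.optValue M G.u - ε / 2 ≤ G.minUtility (typeSpace lo δ) π :=
    le_ciInf fun θ' => (hπ δ hδ lo hlo θ'.1 θ'.2).1
  have h₂ := G.minUtility_le ρ hθ
  constructor <;> linarith [hρ π, G.Ev_le_optValue θ ρ, (hπ δ hδ lo hlo θ hθ).2]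

lemma StablePolicyCondition.robustRegret [Nonempty M] (hM : Fintype.card Ω ≤ Fintype.card M)
    (h : G.StablePolicyCondition M) : G.RobustRegret M := by
  intro ε hε
  obtain ⟨π, δ₀, hδ₀, hπ⟩ := h.exists_uniform_policy hM (by linarith : 0 < ε / 4)
  refine ⟨δ₀, hδ₀, fun δ hδ lo hlo θ hθ ρ hρ => abs_lt.2 ?_⟩
  have : Nonempty (typeSpace lo δ) := ⟨⟨θ, hθ⟩⟩
  have h₁ : G.regret (typeSpace lo δ) π ≤ ε / 2 := ciSup_le fun θ' => by
    have := hπ δ hδ lo hlo θ'.1 θ'.2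
    linarith
  have h₂ := G.le_regret (typeSpace lo δ) ρ hθ
  have h₃ := hπ δ hδ lo hlo θ hθ
  constructor <;> linarith [hρ π, G.Ev_le_optValue θ ρ, G.Ev_le_optValue θ π]

end

end BPModel

theorem theorem1 {Ω A M : Type*} [Fintype Ω] [Fintype A] [Nonempty A] [Fintype M]
    (G : BPModel Ω A) (hM : Fintype.card Ω ≤ Fintype.card M) :
    (G.RobustRegret M ↔ G.RobustMaxMin M) ∧
    (G.RobustRegret M ↔ G.IsContinuous M) ∧
    (G.RobustMaxMin M ↔ G.IsContinuous M) ∧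
    (G.IsContinuous M ↔ G.StablePolicyCondition M) := by
  have := G.nonempty_states
  have : Nonempty M := Fintype.card_pos_iff.1 (Fintype.card_pos.trans_le hM)
  have h₁ : G.RobustRegret M ↔ G.StablePolicyCondition M :=
    ⟨fun h => h.stablePolicyCondition, fun h => h.robustRegret hM⟩
  have h₂ : G.RobustMaxMin M ↔ G.StablePolicyCondition M :=
    ⟨fun h => h.stablePolicyCondition, fun h => h.robustMaxMin hM⟩
  have h₃ : G.IsContinuous M ↔ G.StablePolicyCondition M :=
    ⟨fun h => h.stablePolicyCondition, fun h => h.isContinuous hM⟩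
  exact ⟨h₁.trans h₂.symm, h₁.trans h₃.symm, h₂.trans h₃.symm, h₃⟩
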